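/- Let $p\ge 4$ be an even integer. All graphs are finite and simple. A circuit of length $p$ in a graph is a sequence $(v_1,\dots,v_p)$ of (not necessarily distinct) vertices such that $\{v_1,v_2\},\dots,\{v_{p-1},v_p\},\{v_p,v_1\}$ are $p$ pairwise distinct edges of the graph. If $G$ is a graph on $v$ vertices with $e$ edges and without circuit of length $p$, then $$e\le 18\pi^2p^2\,v^{1+2/p}.$$ If $G$ is furthermore a bipartite graph whose two vertex classes have respectively $m$ and $n$ elements, then $$e\le 9\pi^2p^2\,\min(m,n)^{2/p}\max(m,n).$$ -/

import Mathlib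

/-! Write `p = 2k` and give each edge `uv` the weight `1/√max(d(u), d(v))`. Let `T` be the trace of
`W ^ (2k)`, the total weight of the closed walks of length `2k`; the proof bounds `T` on both sides.

Lower bound: the normalised vector of square roots of degrees has squared Rayleigh quotient at least
`e/|U|`, where `U` contains all non-isolated vertices (`exists_rayleigh_degreeWeight`). Hence `T ≥
(e/|U|)^k` by `pow_le_trace_pow`.

Upper bound (`trace_pow_le_of_trailSum_eq_zero`): without a circuit of length `2k`, every closed
walk of that length repeats an edge. There are at most `(2k)²` ways to place the two passages.
Log-convexity of return weights controls the remaining pieces, giving `T ≤ 16k² ∑ c(u) q(u)^(2k-2)`,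
where `c(u) ≤ 1` is the sum of squares of row `u` and `q(u)^(2k)` is the return weight at `u`.
Hölder's inequality then yields `T ≤ (16k²)^k ∑ c(u)`, and `∑ c(u) ≤ 2|C|` for any vertex cover `C`.
-/

open Finset Matrix

/-! ### Weighted walks, trails and repeated edges -/

section WeightedWalks

variable {V : Type*} [Fintype V] [DecidableEq V]

/-- The total weight of the trails of length `n` from `u` to `v` whose edges avoid the list `S`. -/
noncomputable def trailSum (W : Matrix V V ℝ) : ℕ → List (Sym2 V) → V → V → ℝ
  | 0, _, u, v => if u = v then 1 else 0
  | n + 1, S, u, v =>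
    ∑ x, if s(u, x) ∈ S then 0 else W u x * trailSum W n (s(u, x) :: S) x v

/-- The part of a weight matrix carried by a single edge. -/
noncomputable def edgePart (W : Matrix V V ℝ) (e : Sym2 V) : Matrix V V ℝ :=
  Matrix.of fun u x => if s(u, x) = e then W u x else 0

/-- The total weight of the walks of length `n` with a marked passage through the edge `e`. -/
noncomputable def hitSum (W : Matrix V V ℝ) (e : Sym2 V) : ℕ → Matrix V V ℝ
  | 0 => 0
  | n + 1 => edgePart W e * W ^ n + W * hitSum W e n

/-- The total weight of the walks of length `n` with two marked passages through the same edge. -/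
noncomputable def repeatSum (W : Matrix V V ℝ) : ℕ → Matrix V V ℝ
  | 0 => 0
  | n + 1 => W * repeatSum W n +
      Matrix.of fun u v => ∑ x, W u x * hitSum W s(u, x) n x v

theorem exists_isTrail_of_trailSum_ne_zero {G : SimpleGraph V} {W : Matrix V V ℝ}
    (hW : ∀ u v, W u v ≠ 0 → G.Adj u v) :
    ∀ (n : ℕ) (S : List (Sym2 V)) (u v : V), trailSum W n S u v ≠ 0 →
      ∃ w : G.Walk u v, w.IsTrail ∧ w.length = n ∧ ∀ e ∈ w.edges, e ∉ S := by
  intro n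
  induction n with
  | zero =>
    intro S u v h
    have huv : u = v := by
      by_contra hne
      exact h (by simp [trailSum, hne])
    subst huv
    exact ⟨.nil, by simp⟩
  | succ n ih =>
    intro S u v h
    obtain ⟨x, -, hx⟩ := Finset.exists_ne_zero_of_sum_ne_zero h
    by_cases hS : s(u, x) ∈ S
    · simp [hS] at hx
    · rw [if_neg hS] at hx
      obtain ⟨w, hw, hl, he⟩ := ih _ _ _ (right_ne_zero_of_mul hx)
      refine ⟨.cons (hW _ _ (left_ne_zero_of_mul hx)) w, ?_, by simp [hl], ?_⟩
      · rw [SimpleGraph.Walk.isTrail_cons]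
        exact ⟨hw, fun hmem => he _ hmem (by simp)⟩
      · intro e hmem
        rw [SimpleGraph.Walk.edges_cons, List.mem_cons] at hmem
        rcases hmem with rfl | hmem
        · exact hS
        · exact fun h' => he e hmem (List.mem_cons_of_mem _ h')

omit [Fintype V] in
theorem edgePart_nonneg {W : Matrix V V ℝ} (hW : ∀ u v, 0 ≤ W u v) (e : Sym2 V) (u v : V) :
    0 ≤ edgePart W e u v := by
  simp only [edgePart, Matrix.of_apply]
  split_ifs
  exacts [hW _ _, le_rfl]

theorem hitSum_nonneg {W : Matrix V V ℝ} (hW : ∀ u v, 0 ≤ W u v) (e : Sym2 V) (n : ℕ) (u v : V) :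
    0 ≤ hitSum W e n u v := by
  induction n generalizing u with
  | zero => simp [hitSum]
  | succ n ih =>
    simp only [hitSum, Matrix.add_apply, Matrix.mul_apply]
    exact add_nonneg
      (Finset.sum_nonneg fun x _ => mul_nonneg (edgePart_nonneg hW _ _ _) (pow_apply_nonneg hW _ _ _))
      (Finset.sum_nonneg fun x _ => mul_nonneg (hW _ _) (ih _))

theorem repeatSum_nonneg {W : Matrix V V ℝ} (hW : ∀ u v, 0 ≤ W u v) (n : ℕ) (u v : V) :
    0 ≤ repeatSum W n u v := by
  induction n generalizing u with
  | zero => simp [repeatSum]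
  | succ n ih =>
    simp only [repeatSum, Matrix.add_apply, Matrix.mul_apply, Matrix.of_apply]
    exact add_nonneg (Finset.sum_nonneg fun x _ => mul_nonneg (hW _ _) (ih _))
      (Finset.sum_nonneg fun x _ => mul_nonneg (hW _ _) (hitSum_nonneg hW _ _ _ _))

omit [DecidableEq V] in
theorem list_sum_map_finset_sum (S : List (Sym2 V)) (f : Sym2 V → V → ℝ) :
    (S.map fun e => ∑ x, f e x).sum = ∑ x, (S.map fun e => f e x).sum := by
  induction S with
  | nil => simp
  | cons a S ih => simp only [List.map_cons, List.sum_cons, ih, Finset.sum_add_distrib]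

/-- A walk is a trail avoiding `S`, or passes through `S`, or passes twice through an edge. -/
theorem pow_apply_le_trailSum_add {W : Matrix V V ℝ} (hW : ∀ u v, 0 ≤ W u v) :
    ∀ (n : ℕ) (S : List (Sym2 V)) (u v : V),
      (W ^ n) u v ≤
        trailSum W n S u v + (S.map fun e => hitSum W e n u v).sum + repeatSum W n u v := by
  intro n
  induction n with
  | zero =>
    intro S u v
    simp [trailSum, hitSum, repeatSum, Matrix.one_apply]
  | succ n ih =>
    intro S u v
    -- A first step inside `S` is paid for by `hitSum`. Otherwise its edge joins `S`, and the extra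
    -- `hitSum` term this creates is exactly the new term of `repeatSum`.
    have key : ∀ x, W u x * (W ^ n) x v ≤
        (if s(u, x) ∈ S then 0 else W u x * trailSum W n (s(u, x) :: S) x v) +
        (S.map fun e => edgePart W e u x * (W ^ n) x v + W u x * hitSum W e n x v).sum +
        (W u x * repeatSum W n x v + W u x * hitSum W s(u, x) n x v) := by
      intro x
      have hr := mul_nonneg (hW u x) (repeatSum_nonneg hW n x v)
      have hh := mul_nonneg (hW u x) (hitSum_nonneg hW s(u, x) n x v)
      by_cases hS : s(u, x) ∈ S
      · rw [if_pos hS]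
        have hmem : edgePart W s(u, x) u x * (W ^ n) x v + W u x * hitSum W s(u, x) n x v ∈
            S.map fun e => edgePart W e u x * (W ^ n) x v + W u x * hitSum W e n x v :=
          List.mem_map.2 ⟨_, hS, rfl⟩
        have hle := List.single_le_sum (by
          intro y hy
          obtain ⟨e, -, rfl⟩ := List.mem_map.1 hy
          exact add_nonneg (mul_nonneg (edgePart_nonneg hW _ _ _) (pow_apply_nonneg hW _ _ _))
            (mul_nonneg (hW _ _) (hitSum_nonneg hW _ _ _ _))) _ hmem
        have he : edgePart W s(u, x) u x = W u x := by simp [edgePart]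
        rw [he] at hle
        linarith
      · rw [if_neg hS]
        have h1 := mul_le_mul_of_nonneg_left (ih (s(u, x) :: S) x v) (hW u x)
        rw [List.map_cons, List.sum_cons] at h1
        have h2 : W u x * (S.map fun e => hitSum W e n x v).sum ≤
            (S.map fun e => edgePart W e u x * (W ^ n) x v + W u x * hitSum W e n x v).sum := by
          rw [← List.sum_map_mul_left]
          refine List.sum_le_sum fun e _ => ?_
          linarith [mul_nonneg (edgePart_nonneg hW e u x) (pow_apply_nonneg hW n x v)]
        nlinarith [h1, h2]
    have hsum := Finset.sum_le_sum fun x (_ : x ∈ (univ : Finset V)) => key x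
    rw [pow_succ', Matrix.mul_apply]
    refine hsum.trans (le_of_eq ?_)
    simp only [trailSum, hitSum, repeatSum, Matrix.add_apply, Matrix.mul_apply, Matrix.of_apply,
      ← Finset.sum_add_distrib, list_sum_map_finset_sum]

/-- The weight of the closed walks that pass twice through the edge of a first marked step. -/
theorem sum_mul_hitSum_le {W : Matrix V V ℝ} {N : ℕ} {B : ℝ}
    (hB : ∀ i j, i + j + 2 = N → ∑ u, ∑ x, W u x * (W ^ i * edgePart W s(u, x) * W ^ j) x u ≤ B)
    (n : ℕ) : ∀ i h, i + n + h + 1 = N →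
      ∑ u, ∑ x, W u x * (W ^ i * hitSum W s(u, x) n * W ^ h) x u ≤ n * B := by
  induction n with
  | zero => intro i h _; simp [hitSum]
  | succ n ih =>
    intro i h hN
    have h1 := hB i (n + h) (by omega)
    have h2 := ih (i + 1) h (by omega)
    have h3 : ∀ e, W ^ i * hitSum W e (n + 1) * W ^ h =
        W ^ i * edgePart W e * W ^ (n + h) + W ^ (i + 1) * hitSum W e n * W ^ h := by
      intro e
      simp only [hitSum, pow_add, pow_one]
      noncomm_ring
    simp only [h3, Matrix.add_apply, mul_add, Finset.sum_add_distrib]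
    push_cast
    linarith

/-- Cyclicity of the trace moves the first marked step to the front of the closed walk. There are
`n` positions for that mark, and fewer than `N` for the second. -/
theorem trace_pow_mul_repeatSum_le {W : Matrix V V ℝ} {N : ℕ} {B : ℝ} (hB0 : 0 ≤ B)
    (hB : ∀ i j, i + j + 2 = N → ∑ u, ∑ x, W u x * (W ^ i * edgePart W s(u, x) * W ^ j) x u ≤ B)
    (n : ℕ) : ∀ h, h + n = N → (W ^ h * repeatSum W n).trace ≤ n * (N * B) := by
  induction n with
  | zero => intro h _; simp [repeatSum]
  | succ n ih =>
    intro h hN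
    have h1 := ih (h + 1) (by omega)
    have h2 := sum_mul_hitSum_le hB n 0 h (by omega)
    have h3 : (W ^ h * Matrix.of fun u v => ∑ x, W u x * hitSum W s(u, x) n x v).trace =
        ∑ u, ∑ x, W u x * (W ^ 0 * hitSum W s(u, x) n * W ^ h) x u := by
      simp only [Matrix.trace, Matrix.diag_apply, Matrix.mul_apply, Matrix.of_apply, pow_zero,
        one_mul, Finset.mul_sum]
      rw [Finset.sum_comm]
      refine Finset.sum_congr rfl fun u _ => ?_
      rw [Finset.sum_comm]
      exact Finset.sum_congr rfl fun x _ => Finset.sum_congr rfl fun v _ => by ring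
    have h4 : W ^ h * repeatSum W (n + 1) = W ^ (h + 1) * repeatSum W n +
        W ^ h * Matrix.of fun u v => ∑ x, W u x * hitSum W s(u, x) n x v := by
      simp only [repeatSum, pow_add, pow_one]
      noncomm_ring
    rw [h4, Matrix.trace_add, h3]
    have h5 : (n : ℝ) * B ≤ N * B := by
      gcongr
      omega
    push_cast
    linarith

/-- The two terms are the two directions in which the marked edge can be crossed. Equality fails
only through a loop `u = x`, counted twice. -/
theorem edgePart_mul_apply_le {W : Matrix V V ℝ} (hW : ∀ u v, 0 ≤ W u v) (hs : W.IsSymm)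
    (i j : ℕ) (u x : V) :
    (W ^ i * edgePart W s(u, x) * W ^ j) x u ≤
      W u x * ((W ^ i) x u * (W ^ j) x u + (W ^ i) x x * (W ^ j) u u) := by
  have hK : ∀ a b, edgePart W s(u, x) a b ≤
      (if a = u then if b = x then W u x else 0 else 0) +
      (if a = x then if b = u then W u x else 0 else 0) := by
    intro a b
    have hux : W x u = W u x := hs.apply u x
    have hn := hW u x
    simp only [edgePart, Matrix.of_apply, Sym2.eq_iff]
    by_cases h1 : a = u ∧ b = x
    · obtain ⟨rfl, rfl⟩ := h1
      simp only [true_and, true_or, if_true]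
      split_ifs <;> linarith
    · by_cases h2 : a = x ∧ b = u
      · obtain ⟨rfl, rfl⟩ := h2
        simp only [true_and, or_true, if_true, hux]
        split_ifs <;> linarith
      · rw [if_neg (by tauto)]
        split_ifs <;> linarith
  calc (W ^ i * edgePart W s(u, x) * W ^ j) x u
      = ∑ b, ∑ a, (W ^ i) x a * edgePart W s(u, x) a b * (W ^ j) b u := by
        simp only [Matrix.mul_apply, Finset.sum_mul]
    _ ≤ ∑ b, ∑ a, (W ^ i) x a * ((if a = u then if b = x then W u x else 0 else 0) +
          (if a = x then if b = u then W u x else 0 else 0)) * (W ^ j) b u := by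
        gcongr with b _ a _
        · exact pow_apply_nonneg hW _ _ _
        · exact pow_apply_nonneg hW _ _ _
        · exact hK a b
    _ = _ := by
        simp only [mul_add, add_mul, Finset.sum_add_distrib, mul_ite, ite_mul, mul_zero, zero_mul,
          Finset.sum_ite_eq', Finset.mem_univ, if_true]
        ring

/-! ### Log-convexity of even moments -/

/-- A log-convex sequence starting at `1` has nondecreasing normalised roots. -/
theorem le_pow_of_logConvex {h : ℕ → ℝ} (h0 : h 0 = 1) (hn : ∀ j, 0 ≤ h j)
    (hc : ∀ j, h (j + 1) ^ 2 ≤ h j * h (j + 2)) {r : ℝ} (hr : 0 ≤ r) {k : ℕ} (hk : h k ≤ r ^ k) :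
    ∀ j ≤ k, h j ≤ r ^ j := by
  -- This is monotonicity of `h j ^ (1/j)`, written without roots.
  have step : ∀ j, h j ^ (j + 1) ≤ h (j + 1) ^ j := by
    intro j
    induction j with
    | zero => simp [h0]
    | succ j ih =>
      rcases (hn (j + 1)).eq_or_lt with h1 | h1
      · rw [← h1, zero_pow (by omega)]
        exact pow_nonneg (hn _) _
      · have h2 : h (j + 1) ^ j * h (j + 1) ^ (j + 2) ≤ h (j + 1) ^ j * h (j + 2) ^ (j + 1) := by
          calc h (j + 1) ^ j * h (j + 1) ^ (j + 2) = (h (j + 1) ^ 2) ^ (j + 1) := by ring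
            _ ≤ (h j * h (j + 2)) ^ (j + 1) := by gcongr; exact hc j
            _ = h j ^ (j + 1) * h (j + 2) ^ (j + 1) := by ring
            _ ≤ _ := by gcongr; exact pow_nonneg (hn _) _
        exact le_of_mul_le_mul_left h2 (pow_pos h1 _)
  intro j hj
  induction hj using Nat.decreasingInduction with
  | self => exact hk
  | of_succ j hj ih =>
    refine le_of_pow_le_pow_left₀ (Nat.succ_ne_zero j) (by positivity) ?_
    calc h j ^ (j + 1) ≤ h (j + 1) ^ j := step j
      _ ≤ (r ^ (j + 1)) ^ j := by gcongr; exact hn _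
      _ = (r ^ j) ^ (j + 1) := by ring

theorem dotProduct_pow_add {W : Matrix V V ℝ} (hs : W.IsSymm) (f : V → ℝ) (i j : ℕ) :
    f ⬝ᵥ (W ^ (i + j)) *ᵥ f = (W ^ i *ᵥ f) ⬝ᵥ (W ^ j *ᵥ f) := by
  rw [pow_add, ← Matrix.mulVec_mulVec, Matrix.dotProduct_mulVec, ← Matrix.mulVec_transpose,
    (hs.pow i).eq]

omit [DecidableEq V] in
theorem dotProduct_sq_le (f g : V → ℝ) : (f ⬝ᵥ g) ^ 2 ≤ (f ⬝ᵥ f) * (g ⬝ᵥ g) := by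
  simp only [dotProduct, ← sq]
  exact Finset.sum_mul_sq_le_sq_mul_sq _ _ _

theorem moment_logConvex {W : Matrix V V ℝ} (hs : W.IsSymm) (f : V → ℝ) (j : ℕ) :
    (f ⬝ᵥ (W ^ (2 * (j + 1))) *ᵥ f) ^ 2 ≤
      (f ⬝ᵥ (W ^ (2 * j)) *ᵥ f) * (f ⬝ᵥ (W ^ (2 * (j + 2))) *ᵥ f) := by
  have e1 : 2 * (j + 1) = j + (j + 2) := by ring
  rw [e1, two_mul, two_mul, dotProduct_pow_add hs, dotProduct_pow_add hs, dotProduct_pow_add hs]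
  exact dotProduct_sq_le _ _

theorem moment_nonneg {W : Matrix V V ℝ} (hs : W.IsSymm) (f : V → ℝ) (j : ℕ) :
    0 ≤ f ⬝ᵥ (W ^ (2 * j)) *ᵥ f := by
  rw [two_mul, dotProduct_pow_add hs]
  exact Finset.sum_nonneg fun _ _ => mul_self_nonneg _

theorem pow_apply_self_le {W : Matrix V V ℝ} (hs : W.IsSymm) {q : ℝ} {k : ℕ} {u : V}
    (hk : (W ^ (2 * k)) u u ≤ q ^ (2 * k)) {j : ℕ} (hj : j ≤ k) :
    (W ^ (2 * j)) u u ≤ q ^ (2 * j) := by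
  have := le_pow_of_logConvex (h := fun j => (W ^ (2 * j)) u u) (by simp)
    (fun j => by simpa using moment_nonneg hs (Pi.single u 1) j)
    (fun j => by simpa using moment_logConvex hs (Pi.single u 1) j)
    (sq_nonneg q) (k := k) (by simpa [← pow_mul] using hk) j hj
  simpa [← pow_mul] using this

theorem pow_add_apply_sq_le {W : Matrix V V ℝ} (hs : W.IsSymm) (i j : ℕ) (u v : V) :
    ((W ^ (i + j)) u v) ^ 2 ≤ (W ^ (2 * i)) u u * (W ^ (2 * j)) v v := by
  have h1 : ∀ n a b, (W ^ n) a b = (W ^ n) b a := fun n a b => (hs.pow n).apply b a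
  rw [two_mul, two_mul, pow_add, pow_add, pow_add, Matrix.mul_apply, Matrix.mul_apply,
    Matrix.mul_apply]
  refine (Finset.sum_mul_sq_le_sq_mul_sq _ _ _).trans (le_of_eq ?_)
  congr 1
  · exact Finset.sum_congr rfl fun x _ => by rw [h1 i x u, sq]
  · exact Finset.sum_congr rfl fun x _ => by rw [h1 j v x, sq]

/-- Cutting the walk near its midpoint leaves halves of length at most `k`; Cauchy–Schwarz bounds it
by return weights of even length at most `2k`. -/
theorem pow_apply_le_max_pow {W : Matrix V V ℝ} (hW : ∀ u v, 0 ≤ W u v) (hs : W.IsSymm) {q : V → ℝ} (hq : ∀ u, 0 ≤ q u)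
    {k : ℕ} (hk : ∀ u, (W ^ (2 * k)) u u ≤ q u ^ (2 * k)) {n : ℕ} (hn : n ≤ 2 * k) {u v : V} {M : ℝ}
    (hu : q u ≤ M) (hv : q v ≤ M) : (W ^ n) u v ≤ M ^ n := by
  obtain ⟨i, j, hi, hj, rfl⟩ : ∃ i j, i ≤ k ∧ j ≤ k ∧ n = i + j :=
    ⟨n / 2, n - n / 2, by omega, by omega, by omega⟩
  have hM : 0 ≤ M := (hq u).trans hu
  refine (pow_le_pow_iff_left₀ (Matrix.pow_apply_nonneg hW _ _ _) (by positivity) two_ne_zero).1 ?_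
  calc ((W ^ (i + j)) u v) ^ 2 ≤ (W ^ (2 * i)) u u * (W ^ (2 * j)) v v := pow_add_apply_sq_le hs _ _ _ _
    _ ≤ q u ^ (2 * i) * q v ^ (2 * j) := by
        gcongr
        · simpa using moment_nonneg hs (Pi.single v 1) j
        · exact pow_nonneg (hq _) _
        · exact pow_apply_self_le hs (hk u) hi
        · exact pow_apply_self_le hs (hk v) hj
    _ ≤ M ^ (2 * i) * M ^ (2 * j) := by
        have := hq u
        have := hq v
        gcongr
    _ = (M ^ (i + j)) ^ 2 := by ring

/-! ### Trace bounds -/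

/-- The weight of the closed walks with two marked passages through one edge. -/
theorem sum_mul_edgePart_le {W : Matrix V V ℝ} (hW : ∀ u v, 0 ≤ W u v) (hs : W.IsSymm) {q : V → ℝ}
    (hq : ∀ u, 0 ≤ q u) {k : ℕ} (hk : ∀ u, (W ^ (2 * k)) u u ≤ q u ^ (2 * k)) {i j : ℕ}
    (hij : i + j + 2 = 2 * k) :
    ∑ u, ∑ x, W u x * (W ^ i * edgePart W s(u, x) * W ^ j) x u ≤
      4 * ∑ u, (∑ x, W u x ^ 2) * q u ^ (i + j) := by
  have key : ∀ u x, W u x * (W ^ i * edgePart W s(u, x) * W ^ j) x u ≤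
      2 * (W u x ^ 2 * q u ^ (i + j)) + 2 * (W x u ^ 2 * q x ^ (i + j)) := by
    intro u x
    have hb : ∀ a b n, n ≤ 2 * k → (a = u ∨ a = x) → (b = u ∨ b = x) →
        (W ^ n) a b ≤ max (q u) (q x) ^ n := by
      intro a b n hn ha hb
      refine pow_apply_le_max_pow hW hs hq hk hn ?_ ?_
      · rcases ha with rfl | rfl <;> simp
      · rcases hb with rfl | rfl <;> simp
    have hp : ∀ n a b, 0 ≤ (W ^ n) a b := pow_apply_nonneg hW
    have hm : 0 ≤ max (q u) (q x) := le_max_of_le_left (hq u)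
    have h1 : (W ^ i) x u * (W ^ j) x u + (W ^ i) x x * (W ^ j) u u ≤
        2 * max (q u) (q x) ^ (i + j) := by
      have t1 := mul_le_mul (hb x u i (by omega) (by simp) (by simp))
        (hb x u j (by omega) (by simp) (by simp)) (hp _ _ _) (pow_nonneg hm _)
      have t2 := mul_le_mul (hb x x i (by omega) (by simp) (by simp))
        (hb u u j (by omega) (by simp) (by simp)) (hp _ _ _) (pow_nonneg hm _)
      rw [← pow_add] at t1 t2
      linarith
    -- Replacing the maximum by a sum separates the endpoints, so that the bound becomes a sum over
    -- vertices.
    have h2 : max (q u) (q x) ^ (i + j) ≤ q u ^ (i + j) + q x ^ (i + j) := by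
      have := pow_nonneg (hq u) (i + j)
      have := pow_nonneg (hq x) (i + j)
      rcases max_choice (q u) (q x) with h | h <;> rw [h] <;> linarith
    have hux : W x u = W u x := hs.apply u x
    calc W u x * (W ^ i * edgePart W s(u, x) * W ^ j) x u
        ≤ W u x * (W u x * (2 * (q u ^ (i + j) + q x ^ (i + j)))) := by
          refine mul_le_mul_of_nonneg_left ((edgePart_mul_apply_le hW hs i j u x).trans ?_) (hW _ _)
          exact mul_le_mul_of_nonneg_left (by linarith) (hW _ _)
      _ = _ := by rw [hux]; ring
  calc _ ≤ ∑ u, ∑ x, (2 * (W u x ^ 2 * q u ^ (i + j)) + 2 * (W x u ^ 2 * q x ^ (i + j))) := by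
        gcongr with u _ x _
        exact key u x
    _ = _ := by
        simp only [Finset.sum_add_distrib]
        rw [Finset.sum_comm (f := fun u x => 2 * (W x u ^ 2 * q x ^ (i + j)))]
        simp only [Finset.sum_mul, ← Finset.mul_sum]
        ring

/-- If every closed walk of length `2k` repeats an edge, its total weight is controlled by the
row sums of the squared weights. -/
theorem trace_pow_le_of_trailSum_eq_zero {W : Matrix V V ℝ} (hW : ∀ u v, 0 ≤ W u v) (hs : W.IsSymm)
    {k : ℕ} (hk : 1 ≤ k) (hc : ∀ u, ∑ x, W u x ^ 2 ≤ 1)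
    (ht : ∀ u, trailSum W (2 * k) [] u u = 0) :
    (W ^ (2 * k)).trace ≤ (16 * (k : ℝ) ^ 2) ^ k * ∑ u, ∑ x, W u x ^ 2 := by
  set T := (W ^ (2 * k)).trace with hT
  have hdiag : ∀ u, 0 ≤ (W ^ (2 * k)) u u := fun u => pow_apply_nonneg hW _ _ _
  have hT0 : 0 ≤ T := Finset.sum_nonneg fun u _ => hdiag u
  have hc0 : ∀ u, 0 ≤ ∑ x, W u x ^ 2 := fun u => Finset.sum_nonneg fun _ _ => sq_nonneg _
  have hk0 : (0 : ℝ) < k := by exact_mod_cast hk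
  set q : V → ℝ := fun u => ((W ^ (2 * k)) u u) ^ (((2 * k : ℕ) : ℝ)⁻¹) with hqdef
  have hq : ∀ u, 0 ≤ q u := fun u => Real.rpow_nonneg (hdiag u) _
  have hqk : ∀ u, q u ^ (2 * k) = (W ^ (2 * k)) u u := fun u =>
    Real.rpow_inv_natCast_pow (hdiag u) (by omega)
  set A := ∑ u, (∑ x, W u x ^ 2) * q u ^ (2 * k - 2) with hA
  have hA0 : 0 ≤ A := Finset.sum_nonneg fun u _ => mul_nonneg (hc0 u) (pow_nonneg (hq u) _)
  -- `16k² = (2k)(2k) · 4`: the placements of the two marks, times the constant of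
  -- `sum_mul_edgePart_le`.
  have h1 : T ≤ 16 * (k : ℝ) ^ 2 * A := by
    have h2 : T ≤ (repeatSum W (2 * k)).trace := by
      refine Finset.sum_le_sum fun u _ => ?_
      have := pow_apply_le_trailSum_add hW (2 * k) [] u u
      simpa [ht u] using this
    have h3 := trace_pow_mul_repeatSum_le (W := W) (N := 2 * k) (B := 4 * A) (by positivity)
      (fun i j hij => by
        have := sum_mul_edgePart_le hW hs hq (fun u => (hqk u).ge) hij
        rwa [show i + j = 2 * k - 2 by omega] at this) (2 * k) 0 (by omega)
    rw [pow_zero, one_mul] at h3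
    push_cast at h3
    nlinarith
  have h4 : A ^ k ≤ (∑ u, ∑ x, W u x ^ 2) * T ^ (k - 1) := by
    have hTq : T = ∑ u, (q u ^ 2) ^ k := by
      simp only [← pow_mul, hqk]; rfl
    have hAq : A = ∑ u, (∑ x, W u x ^ 2) * (q u ^ 2) ^ (k - 1) := by
      simp only [← pow_mul]
      rw [hA, show 2 * k - 2 = 2 * (k - 1) by omega]
    -- Hölder is applied with exponents `k` and `k/(k-1)`, so `k = 1` is treated apart.
    rcases hk.eq_or_lt with rfl | hk2
    · simp [hAq]
    have hconj : (k : ℝ).HolderConjugate ((k : ℝ) / (k - 1)) := by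
      have : (1 : ℝ) < k := by exact_mod_cast hk2
      exact Real.HolderConjugate.conjExponent this
    have hH := Real.inner_le_Lp_mul_Lq_of_nonneg univ hconj (f := fun u => ∑ x, W u x ^ 2)
      (g := fun u => (q u ^ 2) ^ (k - 1)) (fun u _ => hc0 u) (fun u _ => by positivity)
    have e1 : ∀ u, ((q u ^ 2) ^ (k - 1)) ^ ((k : ℝ) / (k - 1)) = (q u ^ 2) ^ k := by
      intro u
      have : (1 : ℝ) < k := by exact_mod_cast hk2
      rw [← Real.rpow_natCast _ (k - 1), ← Real.rpow_mul (sq_nonneg _), Nat.cast_sub hk,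
        Nat.cast_one, mul_div_cancel₀ _ (by linarith), Real.rpow_natCast]
    simp only [e1, ← hTq, ← hAq, Real.rpow_natCast] at hH
    have hS0 : 0 ≤ ∑ u, (∑ x, W u x ^ 2) ^ k := Finset.sum_nonneg fun u _ => pow_nonneg (hc0 u) _
    calc A ^ k ≤ ((∑ u, (∑ x, W u x ^ 2) ^ k) ^ (1 / (k : ℝ)) * T ^ (1 / ((k : ℝ) / (k - 1)))) ^ k := by
          gcongr
      _ = (∑ u, (∑ x, W u x ^ 2) ^ k) * T ^ (k - 1) := by
          rw [mul_pow, one_div, Real.rpow_inv_natCast_pow hS0 (by omega), one_div_div,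
            ← Real.rpow_natCast (T ^ _), ← Real.rpow_mul hT0, div_mul_cancel₀ _ hk0.ne',
            ← Real.rpow_natCast, Nat.cast_sub hk, Nat.cast_one]
      _ ≤ _ := by
          gcongr with u
          exact pow_le_of_le_one (hc0 u) (hc u) (by omega)
  rcases hT0.eq_or_lt with h5 | h5
  · rw [← h5]
    exact mul_nonneg (by positivity) (Finset.sum_nonneg fun u _ => hc0 u)
  · refine le_of_mul_le_mul_left ?_ (pow_pos h5 (k - 1))
    calc T ^ (k - 1) * T = T ^ k := by rw [← pow_succ]; congr 1; omega
      _ ≤ (16 * (k : ℝ) ^ 2 * A) ^ k := by gcongr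
      _ = (16 * (k : ℝ) ^ 2) ^ k * A ^ k := by rw [mul_pow]
      _ ≤ (16 * (k : ℝ) ^ 2) ^ k * ((∑ u, ∑ x, W u x ^ 2) * T ^ (k - 1)) := by gcongr
      _ = _ := by ring

/-- The trace of an even power dominates the power of any Rayleigh quotient. -/
theorem pow_le_trace_pow {W : Matrix V V ℝ} (hs : W.IsSymm) (k : ℕ) (hk : 1 ≤ k) {f : V → ℝ}
    (hf : f ⬝ᵥ f = 1) : ((f ⬝ᵥ W *ᵥ f) ^ 2) ^ k ≤ (W ^ (2 * k)).trace := by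
  have h1 : (f ⬝ᵥ W *ᵥ f) ^ 2 ≤ f ⬝ᵥ (W ^ (2 * 1)) *ᵥ f := by
    have h := dotProduct_sq_le f (W *ᵥ f)
    have e := dotProduct_pow_add hs f 1 1
    rw [pow_one] at e
    rw [hf, one_mul, ← e] at h
    exact h
  -- The left side is `‖W ^ k f‖²` and the trace is the sum of the squared row norms of `W ^ k`;
  -- Cauchy–Schwarz applies row by row.
  have h2 : f ⬝ᵥ (W ^ (2 * k)) *ᵥ f ≤ (W ^ (2 * k)).trace := by
    rw [two_mul, dotProduct_pow_add hs, pow_add, Matrix.trace]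
    refine Finset.sum_le_sum fun u _ => ?_
    rw [Matrix.diag_apply, Matrix.mul_apply, ← sq]
    have := dotProduct_sq_le ((W ^ k) u) f
    rw [hf, mul_one] at this
    refine this.trans (le_of_eq ?_)
    exact Finset.sum_congr rfl fun x _ => by rw [(hs.pow k).apply u x]
  have hm := moment_nonneg hs f k
  have h3 := le_pow_of_logConvex (h := fun j => f ⬝ᵥ (W ^ (2 * j)) *ᵥ f) (by simp [hf])
    (moment_nonneg hs f) (moment_logConvex hs f)
    (r := (f ⬝ᵥ (W ^ (2 * k)) *ᵥ f) ^ ((k : ℝ)⁻¹)) (Real.rpow_nonneg hm _) (k := k)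
    (Real.rpow_inv_natCast_pow hm (by omega)).ge 1 hk
  refine le_trans ?_ h2
  rw [pow_one] at h3
  calc ((f ⬝ᵥ W *ᵥ f) ^ 2) ^ k ≤ ((f ⬝ᵥ (W ^ (2 * k)) *ᵥ f) ^ ((k : ℝ)⁻¹)) ^ k := by
        gcongr
        exact h1.trans h3
    _ = _ := Real.rpow_inv_natCast_pow hm (by omega)

end WeightedWalks
-- The degree-normalised weight
section DegreeWeight

/-- The right side is `√min(a, b)`. As a function of `1/a`, `√a` is convex and lies above its
tangent at `1/s`; the other reciprocal only lowers the bound. Reciprocals of degrees are easy to sum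
over edges. -/
theorem sqrt_mul_tangent_le {a b s : ℝ} (ha : 0 < a) (hb : 0 < b) (hs : 0 < s) :
    √s * (3 - s * (a⁻¹ + b⁻¹)) / 2 ≤ √a * (√(max a b))⁻¹ * √b := by
  wlog hab : a ≤ b generalizing a b
  · have := this hb ha (le_of_not_ge hab)
    rw [max_comm, add_comm]
    linarith
  rw [max_eq_right hab, mul_assoc, inv_mul_cancel₀ (Real.sqrt_pos.2 hb).ne', mul_one]
  have h1 : √s * (3 - s * (a⁻¹ + b⁻¹)) / 2 ≤ √s * (3 - s * a⁻¹) / 2 := by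
    have : 0 ≤ √s * (s * b⁻¹) := by positivity
    linarith
  refine h1.trans ?_
  obtain ⟨x, hx, rfl⟩ : ∃ x, 0 < x ∧ a = x ^ 2 :=
    ⟨√a, Real.sqrt_pos.2 ha, (Real.sq_sqrt ha.le).symm⟩
  obtain ⟨y, hy, rfl⟩ : ∃ y, 0 < y ∧ s = y ^ 2 :=
    ⟨√s, Real.sqrt_pos.2 hs, (Real.sq_sqrt hs.le).symm⟩
  rw [Real.sqrt_sq hx.le, Real.sqrt_sq hy.le, ← sub_nonneg]
  have : x - y * (3 - y ^ 2 * (x ^ 2)⁻¹) / 2 = (x - y) ^ 2 * (2 * x + y) / (2 * x ^ 2) := by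
    field_simp
    ring
  rw [this]
  positivity

variable {V : Type*} [Fintype V] [DecidableEq V] (G : SimpleGraph V) [DecidableRel G.Adj]

/-- The adjacency matrix normalised by the larger of the two degrees of each edge. -/
noncomputable def degreeWeight : Matrix V V ℝ :=
  Matrix.of fun u v =>
    if G.Adj u v then (√(max (G.degree u : ℝ) (G.degree v)))⁻¹ else 0

omit [DecidableEq V] in
theorem degreeWeight_nonneg (u v : V) : 0 ≤ degreeWeight G u v := by
  simp only [degreeWeight, Matrix.of_apply]
  split_ifs <;> positivity

omit [DecidableEq V] in
theorem degreeWeight_isSymm : (degreeWeight G).IsSymm := by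
  ext u v
  simp only [degreeWeight, Matrix.transpose_apply, Matrix.of_apply, G.adj_comm u v, max_comm]

omit [DecidableEq V] in
theorem adj_of_degreeWeight_ne_zero (u v : V) (h : degreeWeight G u v ≠ 0) : G.Adj u v := by
  by_contra hn
  exact h (by simp [degreeWeight, hn])

omit [DecidableEq V] in
theorem sum_adj_const (u : V) (c : ℝ) :
    ∑ x, (if G.Adj u x then c else 0) = G.degree u * c := by
  rw [← Finset.sum_filter, Finset.sum_const, nsmul_eq_mul, ← G.neighborFinset_eq_filter,
    G.card_neighborFinset_eq_degree]

omit [DecidableEq V] in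
theorem sum_degreeWeight_sq_le (u : V) : ∑ x, degreeWeight G u x ^ 2 ≤ 1 := by
  calc ∑ x, degreeWeight G u x ^ 2 ≤ ∑ x, if G.Adj u x then (G.degree u : ℝ)⁻¹ else 0 := by
        refine Finset.sum_le_sum fun x _ => ?_
        simp only [degreeWeight, Matrix.of_apply]
        split_ifs with h
        · have hd : (0 : ℝ) < G.degree u := by exact_mod_cast G.degree_pos_iff_exists_adj u |>.2 ⟨x, h⟩
          rw [inv_pow, Real.sq_sqrt (by positivity)]
          exact inv_anti₀ hd (le_max_left _ _)
        · simp
    _ = G.degree u * (G.degree u : ℝ)⁻¹ := sum_adj_const G u _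
    _ ≤ 1 := mul_inv_le_one

omit [DecidableEq V] in
/-- The total squared weight is at most twice the size of a vertex cover. -/
theorem sum_sum_degreeWeight_sq_le {C : Finset V} (hC : ∀ u v, G.Adj u v → u ∈ C ∨ v ∈ C) :
    ∑ u, ∑ x, degreeWeight G u x ^ 2 ≤ 2 * (C.card : ℝ) := by
  classical
  have hone : ∑ u, ∑ x, (if u ∈ C then degreeWeight G u x ^ 2 else 0) ≤ (C.card : ℝ) := by
    calc _ ≤ ∑ u, if u ∈ C then (1 : ℝ) else 0 := by
          refine Finset.sum_le_sum fun u _ => ?_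
          split_ifs
          · exact sum_degreeWeight_sq_le G u
          · simp
      _ = _ := by simp
  have hsymm := degreeWeight_isSymm G
  calc ∑ u, ∑ x, degreeWeight G u x ^ 2
      ≤ ∑ u, ∑ x, ((if u ∈ C then degreeWeight G u x ^ 2 else 0) +
          (if x ∈ C then degreeWeight G x u ^ 2 else 0)) := by
        refine Finset.sum_le_sum fun u _ => Finset.sum_le_sum fun x _ => ?_
        rw [hsymm.apply u x]
        have := sq_nonneg (degreeWeight G u x)
        by_cases h : degreeWeight G u x = 0
        · simp [h]
        · rcases hC u x (adj_of_degreeWeight_ne_zero G u x h) with h | h <;> rw [if_pos h] <;>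
            split_ifs <;> linarith
    _ ≤ 2 * (C.card : ℝ) := by
        simp only [Finset.sum_add_distrib]
        rw [Finset.sum_comm (f := fun u x => if x ∈ C then degreeWeight G x u ^ 2 else 0)]
        linarith

omit [DecidableEq V] in
theorem sum_degree_cast : ∑ u, (G.degree u : ℝ) = 2 * (G.edgeFinset.card : ℝ) := by
  exact_mod_cast G.sum_degrees_eq_twice_card_edges

omit [DecidableEq V] in
theorem sum_adj_inv_degree_le {U : Finset V} (hU : ∀ u v, G.Adj u v → u ∈ U) :
    ∑ u, ∑ x, (if G.Adj u x then (G.degree u : ℝ)⁻¹ else 0) ≤ U.card := by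
  classical
  calc _ ≤ ∑ u, if u ∈ U then (1 : ℝ) else 0 := by
        refine Finset.sum_le_sum fun u _ => ?_
        rw [sum_adj_const]
        split_ifs with h
        · exact mul_inv_le_one
        · have : G.degree u = 0 := by
            by_contra hd
            obtain ⟨x, hx⟩ := (G.degree_pos_iff_exists_adj u).1 (Nat.pos_of_ne_zero hd)
            exact h (hU u x hx)
          simp [this]
    _ = _ := by simp

omit [DecidableEq V] in
/-- The vector of square roots of degrees has a large Rayleigh quotient. -/
theorem exists_rayleigh_degreeWeight {U : Finset V} (hU : ∀ u v, G.Adj u v → u ∈ U)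
    (he : 0 < G.edgeFinset.card) :
    ∃ f : V → ℝ, f ⬝ᵥ f = 1 ∧
      (G.edgeFinset.card : ℝ) / U.card ≤ (f ⬝ᵥ degreeWeight G *ᵥ f) ^ 2 := by
  set e : ℝ := (G.edgeFinset.card : ℝ) with hedef
  have he0 : 0 < e := Nat.cast_pos.2 he
  have hU0 : (0 : ℝ) < U.card := by
    rw [Nat.cast_pos, Finset.card_pos]
    obtain ⟨a, ha⟩ := Finset.card_pos.1 he
    induction a with
    | h u v => exact ⟨u, hU u v (by simpa using ha)⟩
  set s := e / U.card with hsdef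
  have hs : 0 < s := div_pos he0 hU0
  set g : V → ℝ := fun u => √(G.degree u : ℝ) with hg
  have hgg : g ⬝ᵥ g = 2 * e := by
    rw [← sum_degree_cast, dotProduct]
    exact Finset.sum_congr rfl fun u _ => Real.mul_self_sqrt (Nat.cast_nonneg _)
  -- Summing the tangent bound over ordered adjacent pairs gives at least `3e√s - s√s|U|`, which is
  -- `2e√s` because `s|U| = e`.
  have hkey : 2 * e * √s ≤ g ⬝ᵥ degreeWeight G *ᵥ g := by
    have hpt : ∀ u x, (if G.Adj u x then √s * 3 / 2 else 0) -
        √s * s / 2 * (if G.Adj u x then (G.degree u : ℝ)⁻¹ else 0) -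
        √s * s / 2 * (if G.Adj x u then (G.degree x : ℝ)⁻¹ else 0) ≤
        g u * (degreeWeight G u x * g x) := by
      intro u x
      by_cases h : G.Adj u x
      · have hu : (0 : ℝ) < G.degree u := by
          exact_mod_cast (G.degree_pos_iff_exists_adj u).2 ⟨x, h⟩
        have hx : (0 : ℝ) < G.degree x := by
          exact_mod_cast (G.degree_pos_iff_exists_adj x).2 ⟨u, h.symm⟩
        have := sqrt_mul_tangent_le hu hx hs
        simp only [h, h.symm, if_true, degreeWeight, Matrix.of_apply, hg]
        linarith
      · have h' : ¬ G.Adj x u := fun h' => h h'.symm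
        simp [h, h', degreeWeight]
    have hsum := Finset.sum_le_sum fun u (_ : u ∈ (univ : Finset V)) =>
      Finset.sum_le_sum fun x (_ : x ∈ (univ : Finset V)) => hpt u x
    have hinv := sum_adj_inv_degree_le G hU
    have hinv2 : ∑ u, ∑ x, (if G.Adj x u then (G.degree x : ℝ)⁻¹ else 0) ≤ U.card := by
      rw [Finset.sum_comm]
      exact hinv
    have hconst : ∑ u, ∑ x, (if G.Adj u x then √s * 3 / 2 else 0) = 2 * e * (√s * 3 / 2) := by
      simp only [sum_adj_const, ← Finset.sum_mul, sum_degree_cast, hedef]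
    simp only [Finset.sum_sub_distrib, ← Finset.mul_sum, hconst] at hsum
    have hss : s * U.card = e := div_mul_cancel₀ _ hU0.ne'
    have h1 := mul_le_mul_of_nonneg_left hinv (show 0 ≤ √s * s / 2 by positivity)
    have h2 := mul_le_mul_of_nonneg_left hinv2 (show 0 ≤ √s * s / 2 by positivity)
    have h3 : √s * s / 2 * U.card = √s * e / 2 := by rw [← hss]; ring
    rw [h3] at h1 h2
    simp only [dotProduct, Matrix.mulVec]
    linarith
  refine ⟨(√(2 * e))⁻¹ • g, ?_, ?_⟩
  · rw [smul_dotProduct, dotProduct_smul, hgg, smul_eq_mul, smul_eq_mul, ← mul_assoc, ← mul_inv,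
      Real.mul_self_sqrt (by positivity), inv_mul_cancel₀ (by positivity)]
  · have h1 : √s ≤ ((√(2 * e))⁻¹ • g) ⬝ᵥ degreeWeight G *ᵥ ((√(2 * e))⁻¹ • g) := by
      rw [Matrix.mulVec_smul, smul_dotProduct, dotProduct_smul, smul_eq_mul, smul_eq_mul,
        ← mul_assoc, ← mul_inv, Real.mul_self_sqrt (by positivity), inv_mul_eq_div,
        le_div_iff₀ (by positivity)]
      linarith
    calc s = √s ^ 2 := (Real.sq_sqrt hs.le).symm
      _ ≤ _ := by gcongr

/-- A graph without closed trail of length `2k`, with edges inside `U` and vertex cover `C`, has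
at most `16 k² |U| (2 |C|) ^ (1/k)` edges. -/
theorem card_edgeFinset_le_of_no_circuit {k : ℕ} (hk : 1 ≤ k)
    (hG : ¬ ∃ (u : V) (w : G.Walk u u), w.IsCircuit ∧ w.length = 2 * k)
    {U C : Finset V} (hU : ∀ u v, G.Adj u v → u ∈ U) (hC : ∀ u v, G.Adj u v → u ∈ C ∨ v ∈ C) :
    (G.edgeFinset.card : ℝ) ≤
      16 * (k : ℝ) ^ 2 * U.card * (2 * (C.card : ℝ)) ^ ((k : ℝ)⁻¹) := by
  rcases Nat.eq_zero_or_pos G.edgeFinset.card with he | he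
  · rw [he, Nat.cast_zero]
    positivity
  obtain ⟨f, hf, hfe⟩ := exists_rayleigh_degreeWeight G hU he
  have ht : ∀ u, trailSum (degreeWeight G) (2 * k) [] u u = 0 := by
    intro u
    by_contra h
    obtain ⟨w, hw, hl, -⟩ :=
      exists_isTrail_of_trailSum_ne_zero (adj_of_degreeWeight_ne_zero G) _ _ _ _ h
    refine hG ⟨u, w, ⟨hw, ?_⟩, hl⟩
    rintro rfl
    simp at hl
    omega
  have h1 := trace_pow_le_of_trailSum_eq_zero (degreeWeight_nonneg G) (degreeWeight_isSymm G) hk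
    (sum_degreeWeight_sq_le G) ht
  have h2 := pow_le_trace_pow (degreeWeight_isSymm G) k hk hf
  have h3 := sum_sum_degreeWeight_sq_le G hC
  have h4 : ((G.edgeFinset.card : ℝ) / U.card) ^ k ≤
      (16 * (k : ℝ) ^ 2 * (2 * (C.card : ℝ)) ^ ((k : ℝ)⁻¹)) ^ k := by
    rw [mul_pow, Real.rpow_inv_natCast_pow (by positivity) (by omega)]
    calc ((G.edgeFinset.card : ℝ) / U.card) ^ k ≤ ((f ⬝ᵥ degreeWeight G *ᵥ f) ^ 2) ^ k := by gcongr
      _ ≤ _ := h2.trans (h1.trans (by gcongr))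
  have h5 := le_of_pow_le_pow_left₀ (by omega) (by positivity) h4
  have hU0 : (0 : ℝ) < U.card := by
    rw [Nat.cast_pos, Finset.card_pos]
    obtain ⟨a, ha⟩ := Finset.card_pos.1 he
    induction a with
    | h u v => exact ⟨u, hU u v (by simpa using ha)⟩
  rw [div_le_iff₀ hU0] at h5
  linarith

end DegreeWeight

/-- Let `p ≥ 4` be even and let `G` be a finite simple graph without closed trail (circuit) of
length `p`. Then `e ≤ 18 π² p² v ^ (1 + 2/p)`, and if `G` is bipartite with classes `A`, `B` of
sizes `m`, `n`, then `e ≤ 9 π² p² min(m,n) ^ (2/p) max(m,n)`. -/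
theorem mainTheorem4 {V : Type*} [Fintype V] (G : SimpleGraph V) [Fintype G.edgeSet]
    (p : ℕ) (hp4 : 4 ≤ p) (hp : Even p)
    (hG : ¬ ∃ (u : V) (w : G.Walk u u), w.IsCircuit ∧ w.length = p) :
    (G.edgeFinset.card : ℝ) ≤
        18 * Real.pi ^ 2 * (p : ℝ) ^ 2 * (Fintype.card V : ℝ) ^ (1 + 2 / (p : ℝ)) ∧
      ∀ A B : Finset V, G.IsBipartiteWith (A : Set V) (B : Set V) →
        (G.edgeFinset.card : ℝ) ≤
          9 * Real.pi ^ 2 * (p : ℝ) ^ 2 *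
            (min (A.card : ℝ) (B.card : ℝ)) ^ (2 / (p : ℝ)) *
            max (A.card : ℝ) (B.card : ℝ) := by
  classical
  obtain ⟨k, rfl⟩ := hp
  rw [← two_mul] at hG hp4 ⊢
  have hk : 1 ≤ k := by omega
  have hk0 : (0 : ℝ) < k := by exact_mod_cast hk
  have hexp : 2 / ((2 * k : ℕ) : ℝ) = (k : ℝ)⁻¹ := by
    push_cast
    field_simp
  have hpi : (9 : ℝ) ≤ Real.pi ^ 2 := by nlinarith [Real.pi_gt_three]
  -- The bound `2 ^ (1/k) ≤ 2` turns 16 into 32.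
  have main : ∀ U C : Finset V, (∀ u v, G.Adj u v → u ∈ U) →
      (∀ u v, G.Adj u v → u ∈ C ∨ v ∈ C) →
      (G.edgeFinset.card : ℝ) ≤ 32 * (k : ℝ) ^ 2 * U.card * (C.card : ℝ) ^ ((k : ℝ)⁻¹) := by
    intro U C hU hC
    have h1 := card_edgeFinset_le_of_no_circuit G hk hG hU hC
    have h2 : (2 : ℝ) ^ ((k : ℝ)⁻¹) ≤ 2 := by
      conv_rhs => rw [← Real.rpow_one 2]
      exact Real.rpow_le_rpow_of_exponent_le one_le_two
        (inv_le_one_of_one_le₀ (by exact_mod_cast hk))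
    rw [Real.mul_rpow zero_le_two (Nat.cast_nonneg _)] at h1
    refine (le_of_eq (by congr!)).trans (h1.trans ?_)
    calc _ ≤ 16 * (k : ℝ) ^ 2 * U.card * (2 * (C.card : ℝ) ^ ((k : ℝ)⁻¹)) := by gcongr
      _ = _ := by ring
  rw [hexp]
  constructor
  · have h1 := main univ univ (by simp) (by simp)
    rw [Finset.card_univ] at h1
    rcases (Nat.zero_le (Fintype.card V)).eq_or_lt with h0 | h0
    · rw [← h0, Nat.cast_zero, mul_zero, zero_mul] at h1
      exact h1.trans (by positivity)
    have hv : (0 : ℝ) < Fintype.card V := by exact_mod_cast h0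
    rw [Real.rpow_add hv, Real.rpow_one]
    push_cast
    calc _ ≤ _ := h1
      _ = 32 * ((k : ℝ) ^ 2 * (Fintype.card V * (Fintype.card V : ℝ) ^ ((k : ℝ)⁻¹))) := by ring
      _ ≤ 72 * Real.pi ^ 2 * ((k : ℝ) ^ 2 * (Fintype.card V * (Fintype.card V : ℝ) ^ ((k : ℝ)⁻¹))) := by
        gcongr
        linarith
      _ = _ := by ring
  · intro A B hAB
    have hU : ∀ u v, G.Adj u v → u ∈ A ∪ B := fun u v h => by
      have := hAB.mem_of_adj h
      simp only [Finset.mem_coe] at this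
      rw [Finset.mem_union]
      tauto
    have hA : ∀ u v, G.Adj u v → u ∈ A ∨ v ∈ A := fun u v h => by
      have := hAB.mem_of_adj h
      simp only [Finset.mem_coe] at this
      tauto
    have hB : ∀ u v, G.Adj u v → u ∈ B ∨ v ∈ B := fun u v h => by
      have := hAB.mem_of_adj h
      simp only [Finset.mem_coe] at this
      tauto
    have h1 : (G.edgeFinset.card : ℝ) ≤ 32 * (k : ℝ) ^ 2 * (A ∪ B).card *
        (min (A.card : ℝ) B.card) ^ ((k : ℝ)⁻¹) := by
      rcases min_choice (A.card : ℝ) B.card with h | h <;> rw [h]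
      exacts [main _ _ hU hA, main _ _ hU hB]
    have h2 : ((A ∪ B).card : ℝ) ≤ 2 * max (A.card : ℝ) B.card := by
      have : ((A ∪ B).card : ℝ) ≤ A.card + B.card := by exact_mod_cast Finset.card_union_le A B
      linarith [le_max_left (A.card : ℝ) B.card, le_max_right (A.card : ℝ) B.card]
    push_cast
    -- The factor 64 comes from `|A ∪ B| ≤ 2 max`; it is absorbed since `9π²(2k)² = 36π²k²` and `π²
    -- ≥ 9`.
    calc _ ≤ _ := h1
      _ ≤ 32 * (k : ℝ) ^ 2 * (2 * max (A.card : ℝ) B.card) *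
          (min (A.card : ℝ) B.card) ^ ((k : ℝ)⁻¹) := by gcongr
      _ = 64 * ((k : ℝ) ^ 2 * (min (A.card : ℝ) B.card) ^ ((k : ℝ)⁻¹) *
          max (A.card : ℝ) B.card) := by ring
      _ ≤ 36 * Real.pi ^ 2 * ((k : ℝ) ^ 2 * (min (A.card : ℝ) B.card) ^ ((k : ℝ)⁻¹) *
          max (A.card : ℝ) B.card) := by
        gcongr
        linarith
      _ = _ := by ring
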